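/- Let $\mathbb{K}$ be an algebraically closed field of characteristic zero, let $n\ge 0$ and $0\le r\le n$, and let $$P(Z)=Z^d+a_1(X)Z^{d-1}+\cdots+a_d(X)\in\mathbb{K}[[X_1,\ldots,X_n]][Z]$$ be a Weierstrass polynomial, i.e. $a_i(0)=0$ for all $i=1,\ldots,d$. Suppose that $P$ is quasi-ordinary with discriminant $$\Delta_P(X)=X_1^{\alpha_1}\cdots X_r^{\alpha_r}\,U(X),$$ where $\alpha_1,\ldots,\alpha_r\in\mathbb{N}$ (zero allowed) and $U\in\mathbb{K}[[X_1,\ldots,X_n]]$ satisfies $U(0)\neq 0$. Then there is an integer $q\ge 1$ such that $P$ has all its roots in $\mathbb{K}[[X_1^{1/q},\ldots,X_r^{1/q},X_{r+1},\ldots,X_n]]$. That is, there are $f_1,\ldots,f_d$ in this ring with $P(Z)=\prod_{j=1}^d (Z-f_j)$. Here $\mathbb{K}[[X_1^{1/q},\ldots,X_r^{1/q},X_{r+1},\ldots,X_n]]$ is the ring of formal power series $\mathbb{K}[[Y_1,\ldots,Y_n]]$, regarded as an extension of $\mathbb{K}[[X_1,\ldots,X_n]]$ through $X_i=Y_i^q$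 for $i\le r$ and $X_i=Y_i$ for $i>r$. -/

import Mathlib

namespace AbhyankarJung

open Polynomial

/-- A Weierstrass polynomial over `K[[X₁, …, Xₙ]]`: a monic polynomial
`Z ^ d + a₁ Z ^ (d - 1) + ⋯ + a_d` such that `aᵢ(0) = 0` for all `i = 1, …, d`. -/
def IsWeierstrass {K : Type*} [Field K] {n : ℕ} (P : (MvPowerSeries (Fin n) K)[X]) : Prop :=
  P.Monic ∧ ∀ i < P.natDegree, MvPowerSeries.constantCoeff (P.coeff i) = 0

/-- The power series `X₁ ^ q, …, X_r ^ q, X_{r+1}, …, Xₙ` (the variables are numbered from `0`). -/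
noncomputable def powVar (K : Type*) [Field K] (n r q : ℕ) (i : Fin n) :
    MvPowerSeries (Fin n) K :=
  if (i : ℕ) < r then MvPowerSeries.X i ^ q else MvPowerSeries.X i

theorem hasSubst_powVar (K : Type*) [Field K] (n r : ℕ) {q : ℕ} (hq : q ≠ 0) :
    MvPowerSeries.HasSubst (powVar K n r q) := by
  apply MvPowerSeries.hasSubst_of_constantCoeff_zero
  intro i
  unfold powVar
  split_ifs <;> simp [hq]

/-- The inclusion of `K[[X₁, …, Xₙ]]` into `K[[X₁^(1/q), …, X_r^(1/q), X_{r+1}, …, Xₙ]]`.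
The latter is the ring of formal power series in the variables `Yᵢ = Xᵢ^(1/q)` for `i ≤ r` and
`Yᵢ = Xᵢ` for `i > r`; so a series `a(X)` is sent to
`a(Y₁ ^ q, …, Y_r ^ q, Y_{r+1}, …, Yₙ)`. -/
noncomputable def toRootSeries (K : Type*) [Field K] (n r : ℕ) {q : ℕ} (hq : q ≠ 0) :
    MvPowerSeries (Fin n) K →+* MvPowerSeries (Fin n) K :=
  (MvPowerSeries.substAlgHom (R := K) (hasSubst_powVar K n r hq)).toRingHom

/-- The polynomial `P` over `K[[X₁, …, Xₙ]]` has its roots in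
`K[[X₁^(1/q), …, X_r^(1/q), X_{r+1}, …, Xₙ]]`: over this ring it is the product of
`Z - f₁, …, Z - f_d`, where `d` is its degree (`P` is meant to be monic). -/
def HasRootsInRootSeries {K : Type*} [Field K] {n : ℕ} (P : (MvPowerSeries (Fin n) K)[X])
    (r : ℕ) {q : ℕ} (hq : q ≠ 0) : Prop :=
  ∃ f : Fin P.natDegree → MvPowerSeries (Fin n) K,
    P.map (toRootSeries K n r hq) = ∏ j, (X - C (f j))

end AbhyankarJung

/-!
Write `R = K[[X₁, …, Xₙ]]`. The proof is the argument that an extension of `R` which is unramified in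
codimension one is trivial, carried out with derivations and without any purity theorem.

*Ramification in codimension one.* By the theorem of Puiseux over an algebraically closed field `Ω`
of characteristic zero (`exists_splits_map_expand`), there is a `q` depending only on `deg P` such
that every monic polynomial of that degree over `Ω[[Y]]` splits after `Y ↦ Y ^ q`. Let `Q` be the
image of `P` under `Xᵢ ↦ Xᵢ ^ q` for `i ≤ r`. Take `Ω` to be an algebraic closure of the fraction
field of `R` and embed `R` into `Ω[[Y]]` by `Xᵢ ↦ Xᵢ * Y`, the other variables being fixed
(`gradeHom`). Then `Q` splits in `Ω[[Y]]`, for each `i ≤ r`.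

*Derivatives of roots are integral.* The partial derivatives extend to commuting derivations of `Ω`
(`exists_derivations`), and also to derivations of `Ω[[Y]]` for each of these embeddings
(`exists_derivation_powerSeries`). Let `y` be an iterated derivative of a root of `Q` in `Ω`. It is a
polynomial in that root with coefficients in `R[1 / discr Q]`
(`exists_pow_discr_mul_eq_eval₂`), so the monic polynomial having as roots the same derivative of
all the roots of `Q` has coefficients in `R[1 / discr Q]`. As `discr Q` is a monomial in
`X₁, …, X_r` times a unit, the only possible denominators are these variables, and they are excluded
by the embeddings into `Ω[[Y]]`: there the derivatives of the roots have no pole. Hence `y` is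
integral over `R` (`exists_monic_map_eq_prod_iterate`).

*Taylor expansion.* Let `S` be the `R`-algebra generated by all iterated derivatives of the roots of
`Q`. It is integral over `R` and stable under the derivations `∂ᵢ`. Since `K` is algebraically closed,
the constant coefficient `R → K` extends to a ring homomorphism `ε : S → K`. The Taylor expansion
`s ↦ ∑ ε(∂^α s) / α! X^α` is a ring homomorphism `S → R` which is the identity on `R`
(`exists_taylor_retraction`). It maps the roots of `Q` in `S` to roots in `R`, and `Q` is the product
of the corresponding linear factors.
-/

open Polynomial

namespace AbhyankarJung

/-! ### Derivations -/

/-- The derivations of a commutative ring `A` over `ℤ`. The `ℤ`-algebra structure is the one that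
comes with the ring structure of `A`, also when `A` is a ring of power series over a `ℤ`-algebra. -/
abbrev IntDerivation (A : Type*) [CommRing A] :=
  Derivation ℤ A A

/-- An additive endomorphism satisfying the Leibniz rule, as a derivation over `ℤ`. -/
def intDerivation {A : Type*} [CommRing A] (f : A →+ A)
    (h : ∀ a b, f (a * b) = a • f b + b • f a) : IntDerivation A :=
  Derivation.mk' f.toIntLinearMap h

/-- The partial derivative `∂/∂X i` of power series, as a derivation over `ℤ`. -/
noncomputable def pderivInt (K : Type*) {σ : Type*} [Field K] (i : σ) :
    IntDerivation (MvPowerSeries σ K) :=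
  intDerivation (MvPowerSeries.pderiv K i : _ →+ _)
    (MvPowerSeries.pderiv K i).leibniz

theorem pderivInt_apply {K σ : Type*} [Field K] (i : σ) (a : MvPowerSeries σ K) :
    pderivInt K i a = MvPowerSeries.pderiv K i a := rfl

/-- Derivations extend along formally étale algebras `R → Ω`, because
`Ω ⊗ Ω[R⁄ℤ] → Ω[Ω⁄ℤ]` is an isomorphism. -/
theorem exists_derivation_extension {R Ω : Type*} [CommRing R] [CommRing Ω] [Algebra R Ω]
    [Algebra.FormallyEtale R Ω] (d : IntDerivation R) :
    ∃ D : IntDerivation Ω, ∀ a, D (algebraMap R Ω a) = algebraMap R Ω (d a) := by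
  let e := KaehlerDifferential.tensorKaehlerEquivOfFormallyEtale ℤ R Ω
  let l : KaehlerDifferential ℤ R →ₗ[R] Ω :=
    (Algebra.linearMap R Ω).comp d.liftKaehlerDifferential
  refine ⟨((l.liftBaseChange Ω).comp e.symm.toLinearMap).compDer (KaehlerDifferential.D ℤ Ω), ?_⟩
  intro a
  change l.liftBaseChange Ω (e.symm (KaehlerDifferential.D ℤ Ω (algebraMap R Ω a))) = _
  rw [KaehlerDifferential.tensorKaehlerEquivOfFormallyEtale_symm_D_algebraMap]
  simp [l]

theorem derivation_eq_of_formallyUnramified {R Ω : Type*} [CommRing R] [CommRing Ω] [Algebra R Ω]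
    [Algebra.FormallyUnramified R Ω] (D E : IntDerivation Ω)
    (h : ∀ a, D (algebraMap R Ω a) = E (algebraMap R Ω a)) : D = E := by
  have h0 : ∀ a, (D - E) (algebraMap R Ω a) = 0 := fun a => by simp [h]
  let δ : Derivation R Ω Ω := Derivation.mk'
    { toFun := fun x => (D - E) x
      map_add' := map_add (D - E)
      map_smul' := fun a x => by
        rw [Algebra.smul_def, Derivation.leibniz, h0, smul_zero, add_zero, smul_eq_mul,
          RingHom.id_apply, Algebra.smul_def] } (D - E).leibniz
  have hδ : δ = 0 := by
    have : Subsingleton (Ω[Ω⁄R]) := inferInstance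
    rw [← Derivation.liftKaehlerDifferential_comp δ, Subsingleton.elim δ.liftKaehlerDifferential 0]
    ext; simp
  ext x
  exact sub_eq_zero.1 (congrArg (fun f : Derivation R Ω Ω => f x) hδ)

/-- The partial derivatives extend to a formally étale algebra over the power series ring. The
extensions commute, as their commutators vanish on power series. -/
theorem exists_derivations {K Ω σ : Type*} [Field K] [CommRing Ω] [Algebra (MvPowerSeries σ K) Ω]
    [Algebra.FormallyEtale (MvPowerSeries σ K) Ω] :
    ∃ D : σ → IntDerivation Ω, (∀ i j x, D i (D j x) = D j (D i x)) ∧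
      ∀ k a, D k (algebraMap (MvPowerSeries σ K) Ω a) =
        algebraMap _ Ω (MvPowerSeries.pderiv K k a) := by
  choose D hD using fun k : σ => exists_derivation_extension (Ω := Ω)
    (pderivInt K k)
  refine ⟨D, fun i j x => ?_, hD⟩
  have h : ⁅D i, D j⁆ = 0 := by
    refine derivation_eq_of_formallyUnramified (R := MvPowerSeries σ K) _ _ fun a => ?_
    rw [Derivation.commutator_apply, hD, hD, hD, hD, ← map_sub, Derivation.zero_apply]
    convert map_zero (algebraMap (MvPowerSeries σ K) Ω)
    ext e
    simp only [pderivInt_apply, map_sub, MvPowerSeries.coeff_pderiv]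
    rw [add_right_comm, map_zero]
    by_cases hij : i = j
    · subst hij; ring
    · simp [Finsupp.single_eq_of_ne hij, Finsupp.single_eq_of_ne (Ne.symm hij)]
      ring
  exact sub_eq_zero.1 (by
    rw [← Derivation.commutator_apply, h]; rfl)

/-! ### Taylor expansion along derivations -/

open scoped IsMulCommutative in
/-- Taylor expansion. Let `S` be an algebra over the ring of power series with commuting derivations
`D i` extending the partial derivatives, and let `ε` be a `K`-valued point of `S` over the origin. Then
`s ↦ ∑ ε(D^α s) / α! X^α` is a ring homomorphism that splits the structure map. -/
theorem exists_taylor_retraction {K σ S : Type*} [Field K] [CharZero K] [CommRing S]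
    [Algebra (MvPowerSeries σ K) S] (D : σ → IntDerivation S)
    (hcomm : ∀ i j s, D i (D j s) = D j (D i s))
    (hD : ∀ i a, D i (algebraMap (MvPowerSeries σ K) S a) =
      algebraMap _ S (MvPowerSeries.pderiv K i a))
    (ε : S →+* K) (hε : ∀ a, ε (algebraMap (MvPowerSeries σ K) S a) = MvPowerSeries.constantCoeff a) :
    ∃ T : S →+* MvPowerSeries σ K, ∀ a, T (algebraMap _ S a) = a := by
  classical
  let s : Set (Module.End ℤ S) := Set.range fun i => (D i).toLinearMap
  have hs : ∀ a ∈ s, ∀ b ∈ s, a * b = b * a := by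
    rintro _ ⟨i, rfl⟩ _ ⟨j, rfl⟩
    ext x
    exact hcomm i j x
  have := Algebra.isMulCommutative_adjoin ℤ hs
  let : CommRing (Algebra.adjoin ℤ s) := inferInstance
  let φ : MvPolynomial σ ℤ →+* Algebra.adjoin ℤ s :=
    MvPolynomial.eval₂Hom (Int.castRingHom _) fun i => ⟨_, Algebra.subset_adjoin ⟨i, rfl⟩⟩
  -- the iterated derivation with multi-index `α`
  let op (α : σ →₀ ℕ) : Module.End ℤ S := (φ (MvPolynomial.monomial α 1)).1
  have op_zero : op 0 = 1 := by
    change (φ 1).1 = 1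
    rw [map_one]; rfl
  have op_add (α : σ →₀ ℕ) (i : σ) (x : S) : op (α + Finsupp.single i 1) x = op α (D i x) := by
    have h : φ (MvPolynomial.monomial (α + Finsupp.single i 1) 1) =
        φ (MvPolynomial.monomial α 1) * ⟨_, Algebra.subset_adjoin ⟨i, rfl⟩⟩ := by
      rw [show (MvPolynomial.monomial (α + Finsupp.single i 1) (1 : ℤ)) =
        MvPolynomial.monomial α 1 * MvPolynomial.X i by
          rw [MvPolynomial.X, MvPolynomial.monomial_mul, one_mul], map_mul]
      congr 1
      simp [φ]
    change (φ (MvPolynomial.monomial (α + Finsupp.single i 1) 1)).1 x = _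
    rw [h]; rfl
  let T (x : S) : MvPowerSeries σ K := fun α => ε (op α x) / (α.prod fun _ m => (m.factorial : K))
  have fact_ne (α : σ →₀ ℕ) : (α.prod fun _ m => (m.factorial : K)) ≠ 0 :=
    Finset.prod_ne_zero_iff.2 fun i _ => Nat.cast_ne_zero.2 (Nat.factorial_ne_zero _)
  have coeff_T (α : σ →₀ ℕ) (x : S) : MvPowerSeries.coeff α (T x) =
      ε (op α x) / (α.prod fun _ m => (m.factorial : K)) := rfl
  have const_T (x : S) : MvPowerSeries.constantCoeff (T x) = ε x := by
    rw [← MvPowerSeries.coeff_zero_eq_constantCoeff_apply, coeff_T, op_zero]; simp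
  have T_D (i : σ) (x : S) : MvPowerSeries.pderiv K i (T x) = T (D i x) := by
    ext α
    rw [MvPowerSeries.coeff_pderiv, coeff_T, coeff_T, op_add]
    have : ((α + Finsupp.single i 1).prod fun _ m => (m.factorial : K)) =
        (α.prod fun _ m => (m.factorial : K)) * (α i + 1) := by
      rw [← Finsupp.mul_prod_erase' (α + Finsupp.single i 1) i _ (by simp),
        ← Finsupp.mul_prod_erase' α i _ (by simp)]
      have h : (α + Finsupp.single i 1).erase i = α.erase i := by
        ext j
        by_cases hj : j = i
        · simp [hj]
        · simp [Finsupp.erase_ne hj]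
      rw [h]
      simp [Nat.factorial_succ]
      ring
    rw [this]
    have h1 := fact_ne α
    have h2 : (α i + 1 : K) ≠ 0 := by exact_mod_cast Nat.succ_ne_zero (α i)
    field_simp
  have T_add (x y : S) : T (x + y) = T x + T y := by
    ext α
    simp [coeff_T, add_div]
  -- Series are compared by induction on the degree: those with equal constant terms
  -- and equal derivatives up to lower degree agree.
  have coeff_ind (f g : MvPowerSeries σ K) (m : ℕ)
      (h0 : MvPowerSeries.constantCoeff f = MvPowerSeries.constantCoeff g)
      (h : ∀ i (α : σ →₀ ℕ), α.degree = m → MvPowerSeries.coeff α (MvPowerSeries.pderiv K i f) =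
        MvPowerSeries.coeff α (MvPowerSeries.pderiv K i g)) (α : σ →₀ ℕ) (hα : α.degree = m + 1) :
      MvPowerSeries.coeff α f = MvPowerSeries.coeff α g := by
    have hne : α ≠ 0 := by rintro rfl; simp at hα
    obtain ⟨i, hi : α i ≠ 0⟩ := Finsupp.ne_iff.mp hne
    obtain ⟨β, rfl⟩ : ∃ β, α = β + Finsupp.single i 1 :=
      ⟨α - Finsupp.single i 1, (tsub_add_cancel_of_le (by
        rw [Finsupp.single_le_iff]; omega)).symm⟩
    have := h i β (by simpa using hα)
    rw [MvPowerSeries.coeff_pderiv, MvPowerSeries.coeff_pderiv] at this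
    exact mul_right_cancel₀ (by exact_mod_cast Nat.succ_ne_zero (β i)) this
  have const_eq (f g : MvPowerSeries σ K) (α : σ →₀ ℕ) (hα : α.degree = 0)
      (h0 : MvPowerSeries.constantCoeff f = MvPowerSeries.constantCoeff g) :
      MvPowerSeries.coeff α f = MvPowerSeries.coeff α g := by
    obtain rfl : α = 0 := (Finsupp.degree_eq_zero_iff α).1 hα
    simpa using h0
  have T_mul (x y : S) : T (x * y) = T x * T y := by
    ext α
    induction hm : α.degree generalizing α x y with
    | zero => exact const_eq _ _ α hm (by simp [const_T])
    | succ m ih =>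
      refine coeff_ind _ _ m (by simp [const_T]) (fun i β hβ => ?_) α hm
      simp only [T_D, Derivation.leibniz, smul_eq_mul, T_add, map_add, ih _ _ _ hβ]
  have T_alg (a : MvPowerSeries σ K) : T (algebraMap _ S a) = a := by
    ext α
    induction hm : α.degree generalizing α a with
    | zero => exact const_eq _ _ α hm (by simp [const_T, hε])
    | succ m ih =>
      refine coeff_ind _ _ m (by simp [const_T, hε]) (fun i β hβ => ?_) α hm
      rw [T_D, hD, ih _ _ hβ]
  refine ⟨{ toFun := T, map_one' := ?_, map_mul' := T_mul, map_zero' := ?_, map_add' := T_add },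
    T_alg⟩
  · rw [← map_one (algebraMap (MvPowerSeries σ K) S), T_alg]
  · rw [← map_zero (algebraMap (MvPowerSeries σ K) S), T_alg]

/-! ### Homomorphisms from integral extensions to an algebraically closed field -/

/-- A `K`-valued point of `R` lifts to an integral extension when `K` is algebraically closed: lying
over gives a maximal ideal, whose residue field is algebraic over `K`. -/
theorem exists_hom_of_isIntegral {R S K : Type*} [CommRing R] [CommRing S] [Field K]
    [IsAlgClosed K] [Algebra R S] [Algebra.IsIntegral R S]
    (hinj : Function.Injective (algebraMap R S)) (π : R →+* K) (hπ : Function.Surjective π) :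
    ∃ ε : S →+* K, ∀ a, ε (algebraMap R S a) = π a := by
  have := RingHom.ker_isMaximal_of_surjective π hπ
  obtain ⟨M, hM, hMπ⟩ := Ideal.exists_ideal_over_maximal_of_isIntegral (S := S) (RingHom.ker π)
    (by rw [(RingHom.injective_iff_ker_eq_bot _).1 hinj]; exact bot_le)
  let : Field (S ⧸ M) := Ideal.Quotient.field M
  let e : R ⧸ RingHom.ker π ≃+* K := RingHom.quotientKerEquivOfSurjective hπ
  let j : R ⧸ RingHom.ker π →+* S ⧸ M := Ideal.quotientMap M (algebraMap R S) hMπ.ge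
  let : Algebra K (S ⧸ M) := (j.comp e.symm.toRingHom).toAlgebra
  have hj (a : R) : algebraMap K (S ⧸ M) (π a) = Ideal.Quotient.mk M (algebraMap R S a) := by
    change j (e.symm (π a)) = _
    have : e.symm (π a) = Ideal.Quotient.mk _ a := by
      rw [RingEquiv.symm_apply_eq]; rfl
    rw [this]; rfl
  have : Algebra.IsIntegral K (S ⧸ M) := ⟨fun x => by
    obtain ⟨s, rfl⟩ := Ideal.Quotient.mk_surjective x
    obtain ⟨p, hp, hps⟩ := Algebra.IsIntegral.isIntegral (R := R) s
    refine ⟨p.map π, hp.map _, ?_⟩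
    rw [eval₂_map]
    have : (algebraMap K (S ⧸ M)).comp π = (Ideal.Quotient.mk M).comp (algebraMap R S) :=
      RingHom.ext hj
    rw [this, ← hom_eval₂, hps, map_zero]⟩
  let E := RingEquiv.ofBijective (algebraMap K (S ⧸ M))
    (IsAlgClosed.algebraMap_bijective_of_isIntegral (k := K) (K := S ⧸ M))
  refine ⟨E.symm.toRingHom.comp (Ideal.Quotient.mk M), fun a => ?_⟩
  change E.symm (Ideal.Quotient.mk M (algebraMap R S a)) = _
  rw [RingEquiv.symm_apply_eq, ← hj]; rfl

/-! ### The theorem of Puiseux -/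

/-- The substitution `Y ↦ Y ^ N` in power series in one variable `Y`. -/
noncomputable def expandHom (F : Type*) [Field F] (N : ℕ) (hN : N ≠ 0) :
    PowerSeries F →+* PowerSeries F :=
  (PowerSeries.expand N hN : PowerSeries F →ₐ[F] PowerSeries F).toRingHom

theorem coeff_expandHom {F : Type*} [Field F] (N : ℕ) (hN : N ≠ 0) (a : PowerSeries F) (m : ℕ) :
    PowerSeries.coeff m (expandHom F N hN a) =
      if N ∣ m then PowerSeries.coeff (m / N) a else 0 := by
  change PowerSeries.coeff m (PowerSeries.expand N hN a) = _
  rw [PowerSeries.coeff_expand]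

theorem expandHom_comp {F : Type*} [Field F] {M N : ℕ} (hM : M ≠ 0) (hN : N ≠ 0) :
    (expandHom F M hM).comp (expandHom F N hN) = expandHom F (M * N) (mul_ne_zero hM hN) :=
  RingHom.ext fun a => (PowerSeries.expand_mul M hM N hN a).symm

/-- A form of Hensel's lemma: over a complete local ring, a monic polynomial whose reduction vanishes
to order exactly `k` at `0` has a monic factor of degree `k`. This is the Weierstrass preparation
theorem, the cofactor being a polynomial by uniqueness of Weierstrass division. -/
theorem exists_factor_of_coeff_mem {A : Type*} [CommRing A] [IsLocalRing A]
    [IsAdicComplete (IsLocalRing.maximalIdeal A) A] {G : A[X]} (hG : G.Monic) {k : ℕ}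
    (hlt : ∀ i < k, G.coeff i ∈ IsLocalRing.maximalIdeal A)
    (hk : G.coeff k ∉ IsLocalRing.maximalIdeal A) :
    ∃ f q : A[X], f.Monic ∧ q.Monic ∧ f.natDegree = k ∧ G = f * q := by
  have hord : ((G : PowerSeries A).map (Ideal.Quotient.mk (IsLocalRing.maximalIdeal A))).order
      = k := by
    rw [PowerSeries.order_eq_nat]
    refine ⟨?_, fun i hi => ?_⟩
    · rwa [PowerSeries.coeff_map, coeff_coe, Ne, Ideal.Quotient.eq_zero_iff_mem]
    · rw [PowerSeries.coeff_map, coeff_coe, Ideal.Quotient.eq_zero_iff_mem]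
      exact hlt i hi
  have hne : (G : PowerSeries A).map (IsLocalRing.residue A) ≠ 0 := by
    intro h
    have h' : (G : PowerSeries A).map (Ideal.Quotient.mk (IsLocalRing.maximalIdeal A)) = 0 := h
    rw [h', PowerSeries.order_zero] at hord
    exact ENat.top_ne_natCast k hord
  obtain ⟨f, h, H⟩ := PowerSeries.exists_isWeierstrassFactorization hne
  have hf := H.isDistinguishedAt
  have hdeg : f.natDegree = k := by
    rw [H.natDegree_eq_toNat_order_map_of_ne_top (IsLocalRing.maximalIdeal.isMaximal A).ne_top,
      hord]; rfl
  have hfo : ((f : PowerSeries A).map (Ideal.Quotient.mk (IsLocalRing.maximalIdeal A))).order.toNat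
      = f.natDegree := by
    have := hf.coe_natDegree_eq_order_map f 1
      (by rw [PowerSeries.constantCoeff_one, ← Ideal.ne_top_iff_one]
          exact (IsLocalRing.maximalIdeal.isMaximal A).ne_top) (by simp)
    rw [← this]; rfl
  have hdiv := modByMonic_add_div G f
  -- Polynomial division by `f` is also the Weierstrass division, which has remainder `0`.
  have key := hf.isWeierstrassDivisorAt'.eq_zero_of_mul_eq
    (q := h - ((G /ₘ f : A[X]) : PowerSeries A))
    (r := G %ₘ f) (by
      rw [hfo]
      exact (degree_modByMonic_lt _ hf.monic).trans_le degree_le_natDegree) (by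
      have h1 : (G : PowerSeries A) = f * h := H.eq_mul
      rw [← hdiv] at h1
      push_cast at h1
      rw [mul_sub, ← h1]; ring)
  rw [key.2, zero_add] at hdiv
  exact ⟨f, G /ₘ f, hf.monic, hf.monic.of_mul_monic_left (by rw [hdiv]; exact hG), hdeg, hdiv.symm⟩

theorem isAdicComplete_maximalIdeal_powerSeries (F : Type*) [Field F] :
    IsAdicComplete (IsLocalRing.maximalIdeal (PowerSeries F)) (PowerSeries F) := by
  rw [PowerSeries.maximalIdeal_eq_span_X]; infer_instance

theorem mem_maximalIdeal_powerSeries {F : Type*} [Field F] (a : PowerSeries F) :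
    a ∈ IsLocalRing.maximalIdeal (PowerSeries F) ↔ PowerSeries.constantCoeff a = 0 := by
  rw [PowerSeries.maximalIdeal_eq_span_X, Ideal.mem_span_singleton, PowerSeries.X_dvd_iff]

theorem monic_taylor {A : Type*} [CommRing A] {P : A[X]} (hP : P.Monic) (a : A) :
    (taylor a P).Monic := by
  rw [Monic, leadingCoeff_taylor, hP]

/-- A monic polynomial over `F[[Y]]` whose reduction has at least two distinct roots is a product of
monic polynomials of smaller degree. -/
theorem exists_factor_of_map_constantCoeff_ne {F : Type*} [Field F] [IsAlgClosed F]
    {G : (PowerSeries F)[X]} (hG : G.Monic)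
    (h : ∀ c, G.map PowerSeries.constantCoeff ≠ (X + C c) ^ G.natDegree) :
    ∃ f q : (PowerSeries F)[X], f.Monic ∧ q.Monic ∧ f.natDegree < G.natDegree ∧
      q.natDegree < G.natDegree ∧ G = f * q := by
  have := isAdicComplete_maximalIdeal_powerSeries F
  set Gb := G.map PowerSeries.constantCoeff with hGb
  have hGbm : Gb.Monic := hG.map _
  have hGbd : Gb.natDegree = G.natDegree := hG.natDegree_map _
  have hpos : Gb.degree ≠ 0 := by
    intro h0
    have h1 : Gb = 1 := hGbm.natDegree_eq_zero.1 (natDegree_eq_of_degree_eq_some h0)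
    refine h 0 ?_
    rw [← hGbd, h1]; simp
  obtain ⟨c, hc⟩ := IsAlgClosed.exists_root Gb hpos
  set Gs := taylor (PowerSeries.C c) G with hGs
  have hGsm : Gs.Monic := monic_taylor hG _
  have hGsd : Gs.natDegree = G.natDegree := natDegree_taylor _ _
  have hmap : Gs.map PowerSeries.constantCoeff = taylor c Gb := by
    rw [hGs, hGb, taylor_apply, taylor_apply, Polynomial.map_comp]; simp
  set Gt := taylor c Gb with hGt
  have hGtm : Gt.Monic := monic_taylor hGbm _
  have hGtd : Gt.natDegree = G.natDegree := by rw [hGt, natDegree_taylor, hGbd]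
  set k := Gt.natTrailingDegree with hk
  have hcoef (i : ℕ) : PowerSeries.constantCoeff (Gs.coeff i) = Gt.coeff i := by
    rw [← hmap, coeff_map]
  obtain ⟨f, q, hf, hq, hfk, hfq⟩ := exists_factor_of_coeff_mem hGsm (k := k)
    (fun i hi => by
      rw [mem_maximalIdeal_powerSeries, hcoef]
      exact coeff_eq_zero_of_lt_natTrailingDegree hi)
    (by
      rw [mem_maximalIdeal_powerSeries, hcoef]
      exact mt trailingCoeff_eq_zero.1 hGtm.ne_zero)
  have hk0 : k ≠ 0 := by
    intro h0
    have h1 : Gt.coeff 0 ≠ 0 := by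
      rw [← h0]; exact mt trailingCoeff_eq_zero.1 hGtm.ne_zero
    apply h1
    rw [hGt, taylor_coeff_zero]; exact hc
  have hke : k ≠ G.natDegree := by
    intro h0
    have h1 : Gt = X ^ G.natDegree := by
      rw [← hGtd]
      exact hGtm.eq_X_pow_iff_natTrailingDegree_eq_natDegree.2 (by rw [hGtd, ← h0])
    refine h (-c) ?_
    have h2 : taylor (-c) Gt = Gb := by rw [hGt, taylor_taylor]; simp
    rw [← h2, h1, taylor_apply]; simp
  have hsum : f.natDegree + q.natDegree = G.natDegree := by
    rw [← hGsd, hfq, hf.natDegree_mul hq]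
  refine ⟨taylor (-PowerSeries.C c) f, taylor (-PowerSeries.C c) q, monic_taylor hf _,
    monic_taylor hq _, ?_, ?_, ?_⟩
  · rw [natDegree_taylor]; omega
  · rw [natDegree_taylor]; omega
  · rw [← taylor_mul, ← hfq, hGs, taylor_taylor]; simp

/-- One step of the Newton–Puiseux algorithm. If the coefficient of degree `natDegree - 1` vanishes, but
not all lower ones do, then after `Y ↦ Y ^ m` the roots can be divided by a power of `Y` so that the
reduction of the resulting polynomial `G` has at least two distinct roots. -/
theorem exists_scaleRoots_eq_map_expand {F : Type*} [Field F] [CharZero F]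
    {P : (PowerSeries F)[X]} (hP : P.Monic) (h1 : P.coeff (P.natDegree - 1) = 0)
    {j : ℕ} (hj : j < P.natDegree) (hj0 : P.coeff j ≠ 0) :
    ∃ (m : ℕ) (hm : m ≠ 0) (v : ℕ) (G : (PowerSeries F)[X]), m ≤ P.natDegree ∧ G.Monic ∧
      G.natDegree = P.natDegree ∧
      P.map (expandHom F m hm) =
        G.scaleRoots (PowerSeries.X ^ v) ∧
      ∀ c, G.map PowerSeries.constantCoeff ≠ (X + C c) ^ G.natDegree := by
  classical
  set e := P.natDegree with he
  -- the vertex at which the first edge of the Newton polygon starts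
  obtain ⟨i, hi, hmin⟩ := Finset.exists_min_image ((Finset.range e).filter fun j => P.coeff j ≠ 0)
    (fun j => ((P.coeff j).order.toNat : ℚ) / ((e - j : ℕ) : ℚ)) ⟨j, by simp [hj, hj0]⟩
  simp only [Finset.mem_filter, Finset.mem_range] at hi hmin
  obtain ⟨hie, hi0⟩ := hi
  set v := (P.coeff i).order.toNat with hv
  have hm : e - i ≠ 0 := by omega
  set m := e - i with hmdef
  let ex := expandHom F m hm
  have hexX : ex PowerSeries.X = PowerSeries.X ^ m := PowerSeries.expand_X m hm
  have hdvd (j : ℕ) (hje : j < e) :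
      ∃ b, ex (P.coeff j) = (PowerSeries.X ^ v) ^ (e - j) * b := by
    by_cases h0 : P.coeff j = 0
    · exact ⟨0, by simp [h0]⟩
    · have h2 := hmin j ⟨hje, h0⟩
      have hp1 : (0 : ℚ) < (m : ℕ) := by exact_mod_cast Nat.pos_of_ne_zero hm
      have hp2 : (0 : ℚ) < ((e - j : ℕ) : ℚ) := by exact_mod_cast (by omega : 0 < e - j)
      rw [div_le_div_iff₀ hp1 hp2] at h2
      have h3 : v * (e - j) ≤ (P.coeff j).order.toNat * m := by exact_mod_cast h2
      have h4 : PowerSeries.X ^ (P.coeff j).order.toNat ∣ P.coeff j :=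
        PowerSeries.X_pow_order_dvd
      obtain ⟨b, hb⟩ := h4
      have : (PowerSeries.X ^ v) ^ (e - j) ∣ ex (P.coeff j) := by
        rw [hb, map_mul, map_pow, hexX, ← pow_mul, ← pow_mul]
        exact (pow_dvd_pow _ (by rw [mul_comm m]; exact h3)).mul_right _
      exact this
  choose! b hb using hdvd
  have hdeg : (∑ j ∈ Finset.range e, C (b j) * X ^ j : (PowerSeries F)[X]).degree < e := by
    refine (degree_sum_le _ _).trans_lt
      ((Finset.sup_lt_iff (WithBot.bot_lt_coe _)).2 fun j hj => ?_)
    exact (degree_C_mul_X_pow_le _ _).trans_lt (by exact_mod_cast Finset.mem_range.1 hj)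
  set G : (PowerSeries F)[X] := X ^ e + ∑ j ∈ Finset.range e, C (b j) * X ^ j with hGdef
  have hGm : G.Monic := monic_X_pow_add hdeg
  have hGd : G.natDegree = e := natDegree_eq_of_degree_eq_some (by
    rw [hGdef, degree_add_eq_left_of_degree_lt (by rwa [degree_X_pow]), degree_X_pow])
  have hGc (j : ℕ) (hj : j < e) : G.coeff j = b j := by
    rw [hGdef, coeff_add, coeff_X_pow, if_neg hj.ne, zero_add, finsetSum_coeff,
      Finset.sum_eq_single j]
    · simp
    · intro k _ hk; rw [coeff_C_mul_X_pow, if_neg hk.symm]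
    · intro h; simp [hj] at h
  have hXv : (PowerSeries.X ^ v : PowerSeries F) ≠ 0 := pow_ne_zero _ PowerSeries.X_ne_zero
  refine ⟨m, hm, v, G, by omega, hGm, hGd, ?_, fun c hc => ?_⟩
  · ext1 j
    rw [coeff_map, coeff_scaleRoots, hGd]
    rcases lt_trichotomy j e with hj | rfl | hj
    · rw [hGc j hj, mul_comm]; exact hb j hj
    · have h2 : G.coeff e = 1 := by rw [← hGd]; exact hGm
      rw [show P.coeff e = 1 from hP, h2]; simp
    · rw [coeff_eq_zero_of_natDegree_lt (by omega), coeff_eq_zero_of_natDegree_lt (by omega)]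
      simp
  · rw [hGd] at hc
    have hbe : b (e - 1) = 0 := by
      have h2 := hb (e - 1) (by omega)
      rw [h1, map_zero] at h2
      exact (mul_eq_zero.1 h2.symm).resolve_left (pow_ne_zero _ hXv)
    have hc0 : c = 0 := by
      have h2 := congrArg (fun p => p.coeff (e - 1)) hc
      simp only [coeff_map, coeff_X_add_C_pow] at h2
      rw [hGc _ (by omega), hbe, show e - (e - 1) = 1 by omega,
        Nat.choose_symm_of_eq_add (show e = (e - 1) + 1 by omega)] at h2
      have he0 : (e : F) ≠ 0 := by exact_mod_cast (by omega : e ≠ 0)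
      simpa [he0] using h2.symm
    have h2 := congrArg (fun p => p.coeff i) hc
    simp only [coeff_map, hc0, C_0, add_zero, coeff_X_pow, if_neg hie.ne, hGc i hie] at h2
    have h3 := congrArg (PowerSeries.coeff (m * v)) (hb i hie)
    rw [coeff_expandHom, if_pos (dvd_mul_right m v), Nat.mul_div_cancel_left _
      (Nat.pos_of_ne_zero hm), ← pow_mul, mul_comm v, ← hmdef, PowerSeries.coeff_X_pow_mul',
      if_pos le_rfl, Nat.sub_self, PowerSeries.coeff_zero_eq_constantCoeff_apply, h2] at h3
    exact PowerSeries.coeff_order hi0 h3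

theorem splits_map_expand_of_dvd {F : Type*} [Field F] {P : (PowerSeries F)[X]} {M N : ℕ}
    (hM : M ≠ 0) (hN : N ≠ 0) (h : M ∣ N)
    (hP : (P.map (expandHom F M hM)).Splits) :
    (P.map (expandHom F N hN)).Splits := by
  obtain ⟨c, rfl⟩ := h
  have hc : c ≠ 0 := right_ne_zero_of_mul hN
  have := hP.map (expandHom F c hc)
  rw [Polynomial.map_map, expandHom_comp hc hM] at this
  simpa only [mul_comm M c] using this

/-- Puiseux's theorem for monic polynomials over `F[[Y]]`, with an exponent that depends only on a
bound for the degree. -/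
theorem exists_splits_map_expand (F : Type*) [Field F] [IsAlgClosed F] [CharZero F] (d : ℕ) :
    ∃ (N : ℕ) (hN : N ≠ 0), ∀ P : (PowerSeries F)[X], P.Monic → P.natDegree ≤ d →
      (P.map (expandHom F N hN)).Splits := by
  induction d with
  | zero =>
    refine ⟨1, one_ne_zero, fun P hP hd => ?_⟩
    rw [hP.natDegree_eq_zero.1 (by omega), Polynomial.map_one]
    exact Splits.one
  | succ d ih =>
    obtain ⟨N, hN, ih⟩ := ih
    have hM := mul_ne_zero (Nat.factorial_ne_zero (d + 1)) hN
    refine ⟨(d + 1).factorial * N, hM, fun P hP hd => ?_⟩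
    rcases hd.lt_or_eq with hd | hd
    · exact splits_map_expand_of_dvd hN _ (Dvd.intro_left _ rfl) (ih P hP (by omega))
    -- the Tschirnhaus transformation removes the coefficient of degree `d`
    let c : PowerSeries F := PowerSeries.C (-((d + 1 : ℕ) : F)⁻¹) * P.coeff d
    suffices h : ∀ Q : (PowerSeries F)[X], Q.Monic → Q.natDegree = d + 1 → Q.coeff d = 0 →
        (Q.map (expandHom F ((d + 1).factorial * N) hM)).Splits by
      have h1 := h (taylor c P) (monic_taylor hP _) (by rw [natDegree_taylor, hd]) (by
        have hlin : (hasseDeriv d P) = C (P.coeff d) + C ((d + 1 : ℕ) : PowerSeries F) * X := by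
          ext1 i
          rw [hasseDeriv_coeff]
          rcases i with _ | _ | i
          · simp
          · have : P.coeff (0 + 1 + d) = 1 := by
              rw [show 0 + 1 + d = P.natDegree by omega]; exact hP
            rw [this]
            rw [show 0 + 1 + d = d + 1 by omega, Nat.choose_succ_self_right, mul_one, coeff_add,
              coeff_C_of_ne_zero (by omega), coeff_C_mul, coeff_X]
            simp
          · rw [coeff_eq_zero_of_natDegree_lt (by omega), mul_zero, coeff_add,
              coeff_C_of_ne_zero (by omega), coeff_C_mul, coeff_X, if_neg (by omega)]
            simp
        rw [taylor_coeff, hlin]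
        simp only [eval_add, eval_C, eval_mul, eval_X, c]
        have h2 : ((d + 1 : ℕ) : PowerSeries F) * PowerSeries.C (-((d + 1 : ℕ) : F)⁻¹) = -1 := by
          rw [← map_natCast (PowerSeries.C (R := F)), ← map_mul, mul_neg,
            mul_inv_cancel₀ (by exact_mod_cast Nat.succ_ne_zero d), map_neg, map_one]
        rw [← mul_assoc, h2]; ring)
      have h2 := h1.comp_X_sub_C ((expandHom F ((d + 1).factorial * N) hM) c)
      have h3 : ∀ φ : PowerSeries F →+* PowerSeries F,
          ((taylor c P).map φ).comp (X - C (φ c)) = P.map φ := fun φ => by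
        rw [taylor_apply, Polynomial.map_comp, comp_assoc]; simp
      rwa [h3] at h2
    intro Q hQ hQd hQc
    by_cases hX : ∀ j < d + 1, Q.coeff j = 0
    · have : Q = X ^ (d + 1) := by
        ext1 j
        rw [coeff_X_pow]
        split_ifs with hj
        · rw [hj, ← hQd]; exact hQ
        · rcases lt_or_gt_of_ne hj with hj | hj
          · exact hX j hj
          · exact coeff_eq_zero_of_natDegree_lt (by omega)
      rw [this, Polynomial.map_pow, Polynomial.map_X]
      exact Splits.X_pow _
    · push Not at hX
      obtain ⟨j, hj, hj0⟩ := hX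
      obtain ⟨m, hm, v, G, hmd, hG, hGd, hGs, hGc⟩ := exists_scaleRoots_eq_map_expand hQ
        (by rw [hQd]; exact hQc) (by rw [hQd]; exact hj) hj0
      obtain ⟨f, q, hf, hq, hfd, hqd, rfl⟩ := exists_factor_of_map_constantCoeff_ne hG hGc
      have h1 := ((ih f hf (by omega)).mul (ih q hq (by omega)))
      rw [← Polynomial.map_mul] at h1
      have h2 := h1.scaleRoots (expandHom F N hN
        (PowerSeries.X ^ v))
      rw [← map_scaleRoots _ _ _ (by rw [hG.leadingCoeff]; simp), ← hGs, Polynomial.map_map] at h2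
      refine splits_map_expand_of_dvd (M := N * m) (mul_ne_zero hN hm) _ ?_ ?_
      · rw [mul_comm N]
        exact mul_dvd_mul_right (Nat.dvd_factorial (Nat.pos_of_ne_zero hm) (by omega)) _
      · rwa [expandHom_comp hN hm] at h2

/-! ### Derivatives of the roots of a polynomial -/

/-- The discriminant lies in the ideal generated by a monic polynomial and its derivative. -/
theorem exists_mul_add_derivative_mul_eq_C_discr {R : Type*} [CommRing R] {Q : R[X]}
    (hQ : Q.Monic) : ∃ u v : R[X], Q * u + derivative Q * v = C Q.discr := by
  nontriviality R
  by_cases hd : Q.natDegree = 0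
  · obtain rfl := hQ.natDegree_eq_zero.1 hd
    exact ⟨C (discr 1), 0, by simp⟩
  · obtain ⟨u, v, -, -, h⟩ := exists_mul_add_mul_eq_C_resultant Q (derivative Q)
      (m := Q.natDegree) (n := Q.natDegree - 1) le_rfl (natDegree_derivative_le Q) (.inl hd)
    rw [resultant_deriv (natDegree_pos_iff_degree_pos.1 (Nat.pos_of_ne_zero hd)),
      hQ.leadingCoeff, mul_one] at h
    refine ⟨C ((-1) ^ (Q.natDegree * (Q.natDegree - 1) / 2)) * u,
      C ((-1) ^ (Q.natDegree * (Q.natDegree - 1) / 2)) * v, ?_⟩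
    rw [mul_left_comm, mul_left_comm (derivative Q), ← mul_add, h, ← C_mul, ← mul_assoc,
      ← mul_pow]
    simp

theorem discr_map_of_monic {R S : Type*} [CommRing R] [CommRing S] [Nontrivial S] {Q : R[X]}
    (hQ : Q.Monic) (φ : R →+* S) : (Q.map φ).discr = φ Q.discr := by
  have : Nontrivial R := φ.domain_nontrivial
  by_cases hd : Q.natDegree = 0
  · obtain rfl := hQ.natDegree_eq_zero.1 hd
    rw [Polynomial.map_one, ← C_1, ← C_1, discr_C, discr_C, map_one]
  · have h1 := resultant_deriv (natDegree_pos_iff_degree_pos.1 (Nat.pos_of_ne_zero hd))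
    have h2 := resultant_deriv (f := Q.map φ) (natDegree_pos_iff_degree_pos.1 (by
      rw [hQ.natDegree_map]; exact Nat.pos_of_ne_zero hd))
    rw [hQ.natDegree_map, derivative_map, resultant_map_map, h1, (hQ.map φ).leadingCoeff,
      hQ.leadingCoeff] at h2
    simp only [mul_one, map_mul, map_pow, map_neg, map_one] at h2
    exact ((isUnit_neg_one.pow _).mul_left_cancel h2).symm

/-- The polynomial obtained by applying an additive map `d` to the coefficients. -/
noncomputable def mapCoeffsAdd {R : Type*} [CommRing R] (d : R →+ R) (p : R[X]) : R[X] :=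
  p.sum fun i a => monomial i (d a)

/-- The chain rule for a derivation `D` of `E` that restricts to the derivation `d` of the ring of
coefficients. -/
theorem derivation_eval₂ {R E : Type*} [CommRing R] [CommRing E] (ψ : R →+* E)
    (d : IntDerivation R) (D : IntDerivation E) (h : ∀ a, D (ψ a) = ψ (d a)) (p : R[X]) (x : E) :
    D (p.eval₂ ψ x) = (mapCoeffsAdd (d : R →+ R) p).eval₂ ψ x + (derivative p).eval₂ ψ x * D x := by
  have hadd (p q : R[X]) : mapCoeffsAdd (d : R →+ R) (p + q) =
      mapCoeffsAdd (d : R →+ R) p + mapCoeffsAdd (d : R →+ R) q :=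
    sum_add_index _ _ _ (by simp) (by simp)
  induction p using Polynomial.induction_on' with
  | add p q hp hq =>
    simp only [eval₂_add, map_add, hadd, hp, hq]; ring
  | monomial n a =>
    have : mapCoeffsAdd (d : R →+ R) (monomial n a) = monomial n (d a) := by
      simp [mapCoeffsAdd, sum_monomial_index]
    rw [this, eval₂_monomial, eval₂_monomial, derivative_monomial, eval₂_monomial,
      Derivation.leibniz, Derivation.leibniz_pow, h]
    simp only [smul_eq_mul, nsmul_eq_mul, map_mul, map_natCast]
    ring

/-- Iterated derivatives of a root `η` of `Q`, multiplied by a power of the discriminant, are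
polynomials in `η`. The polynomial `g` is independent of the ring `E` in which the root lies, so that
roots in different extensions can be compared. -/
theorem exists_pow_discr_mul_eq_eval₂.{u} {R : Type u} {σ : Type*} [CommRing R] {Q : R[X]}
    (hQ : Q.Monic) (d : σ → IntDerivation R) (w : List σ) :
    ∃ (N : ℕ) (g : R[X]), ∀ (E : Type u) [CommRing E] (ψ : R →+* E) (D : σ → IntDerivation E),
      (∀ i a, D i (ψ a) = ψ (d i a)) → ∀ η : E, Q.eval₂ ψ η = 0 →
        ψ Q.discr ^ N * w.foldr (fun i x => D i x) η = g.eval₂ ψ η := by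
  obtain ⟨u, v, huv⟩ := exists_mul_add_derivative_mul_eq_C_discr hQ
  -- differentiating `Q(η) = 0` gives `discr Q * D i η = h i (η)`
  let h (i : σ) : R[X] := -(mapCoeffsAdd (d i : R →+ R) Q * v)
  have hroot (i : σ) (E : Type u) [CommRing E] (ψ : R →+* E) (D : σ → IntDerivation E)
      (hD : ∀ i a, D i (ψ a) = ψ (d i a)) (η : E) (hη : Q.eval₂ ψ η = 0) :
      ψ Q.discr * D i η = (h i).eval₂ ψ η := by
    have h1 := derivation_eval₂ ψ (d i) (D i) (hD i) Q η
    have h2 := congrArg (eval₂ ψ η) huv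
    simp only [eval₂_add, eval₂_mul, eval₂_C, hη, zero_mul, zero_add, map_zero] at h1 h2
    simp only [h, eval₂_neg, eval₂_mul, ← h2]
    linear_combination -eval₂ ψ η v * h1
  induction w with
  | nil => exact ⟨0, X, fun E _ ψ D _ η _ => by simp⟩
  | cons i w ih =>
    obtain ⟨N, g, ih⟩ := ih
    refine ⟨N + 1, C Q.discr * mapCoeffsAdd (d i : R →+ R) g + derivative g * h i -
      C (N * d i Q.discr) * g, fun E _ ψ D hD η hη => ?_⟩
    have h1 := ih E ψ D hD η hη
    have h2 := congrArg (D i) h1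
    rw [derivation_eval₂ ψ (d i) (D i) (hD i) g η, Derivation.leibniz, Derivation.leibniz_pow,
      hD] at h2
    simp only [smul_eq_mul, nsmul_eq_mul] at h2
    have h3 := hroot i E ψ D hD η hη
    simp only [List.foldr_cons, eval₂_add, eval₂_sub, eval₂_mul, eval₂_C, map_mul, map_natCast,
      eval₂_natCast, ← h3, ← h1]
    have h4 : (N : E) * ψ Q.discr ^ (N - 1) * ψ Q.discr = N * ψ Q.discr ^ N := by
      rcases N with _ | N
      · simp
      · rw [Nat.add_sub_cancel, pow_succ]; ring
    set y := w.foldr (fun i x => D i x) η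
    linear_combination ψ Q.discr * h2 - y * ψ (d i Q.discr) * h4

/-- The monic polynomial with roots `g(η)`, for `η` the roots of `Q`, has coefficients in the base
ring: it is the resultant of `Q(Z)` and `X - g(Z)` with respect to `Z`. -/
theorem exists_map_eq_prod_X_sub_C_eval₂.{u} {R : Type u} [CommRing R] {Q : R[X]} (g : R[X]) :
    ∃ χ : R[X], ∀ (E : Type u) [CommRing E] [IsDomain E] (ψ : R →+* E) (η : Fin Q.natDegree → E),
      Q.map ψ = ∏ j, (X - C (η j)) → χ.map ψ = ∏ j, (X - C (g.eval₂ ψ (η j))) := by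
  let gh : R[X][X] := C X - g.map C
  have hgh : gh.natDegree ≤ g.natDegree := by
    refine (natDegree_sub_le _ _).trans ?_
    simp [natDegree_map_le]
  refine ⟨resultant (Q.map C) gh Q.natDegree g.natDegree, fun E _ _ ψ η hη => ?_⟩
  have hmap : gh.map (mapRingHom ψ) = C X - (g.map ψ).map C := by
    simp [gh, Polynomial.map_map]
    congr 1
    ext; simp
  have hQmap : (Q.map C).map (mapRingHom ψ) = ∏ j, (X - C (C (η j))) := by
    rw [Polynomial.map_map, mapRingHom_comp_C, ← Polynomial.map_map, hη, Polynomial.map_prod]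
    simp
  have hdeg : (∏ j : Fin Q.natDegree, (X - C (C (η j) : E[X]))).natDegree = Q.natDegree := by
    rw [natDegree_prod_of_monic _ _ fun j _ => monic_X_sub_C _]; simp
  have h1 := resultant_map_map (Q.map C) gh Q.natDegree g.natDegree (mapRingHom ψ)
  rw [coe_mapRingHom] at h1
  rw [← h1, hQmap]
  have hle : (gh.map (mapRingHom ψ)).natDegree ≤ g.natDegree := natDegree_map_le.trans hgh
  have h2 := resultant_prod_left Finset.univ (fun j => X - C (C (η j) : E[X]))
    (gh.map (mapRingHom ψ)) g.natDegree (by simp) hle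
  rw [hdeg] at h2
  rw [h2]
  refine Finset.prod_congr rfl fun j _ => ?_
  rw [natDegree_X_sub_C, resultant_X_sub_C_left _ _ _ hle, hmap]
  rw [eval_sub, eval_C, eval_map, eval₂_hom, eval_map]

/-! ### Grading a power series by the degree in one variable -/

/-- The part of a power series that is homogeneous of degree `m` in the variable `X i`. -/
def homogeneousPart {K : Type*} [Field K] {σ : Type*} (i : σ) (m : ℕ) (a : MvPowerSeries σ K) :
    MvPowerSeries σ K :=
  fun e => if e i = m then MvPowerSeries.coeff e a else 0

theorem coeff_homogeneousPart {K : Type*} [Field K] {σ : Type*} (i : σ) (m : ℕ)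
    (a : MvPowerSeries σ K) (e : σ →₀ ℕ) : MvPowerSeries.coeff e (homogeneousPart i m a) =
      if e i = m then MvPowerSeries.coeff e a else 0 :=
  rfl

/-- The substitution `X i ↦ X i * Y`: the coefficient of `Y ^ m` is the part of the series which is
homogeneous of degree `m` in the variable `X i`. -/
noncomputable def gradeHom (K : Type*) [Field K] {σ : Type*} (i : σ) :
    MvPowerSeries σ K →+* PowerSeries (MvPowerSeries σ K) where
  toFun a := PowerSeries.mk fun m => homogeneousPart i m a
  map_one' := by
    classical
    ext m e
    rw [PowerSeries.coeff_mk, PowerSeries.coeff_one, coeff_homogeneousPart]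
    by_cases hm : m = 0
    · by_cases he : e = 0
      · simp [hm, he]
      · simp [hm, he, MvPowerSeries.coeff_one]
    · by_cases he : e = 0
      · simp [hm, he, eq_comm]
      · simp [hm, he, MvPowerSeries.coeff_one]
  map_zero' := by
    ext m e
    simp [coeff_homogeneousPart]
  map_add' a b := by
    ext m e
    rw [map_add, map_add, PowerSeries.coeff_mk, PowerSeries.coeff_mk, PowerSeries.coeff_mk,
      coeff_homogeneousPart, coeff_homogeneousPart, coeff_homogeneousPart]
    split_ifs <;> simp
  map_mul' a b := by
    classical
    ext m e
    rw [PowerSeries.coeff_mul, PowerSeries.coeff_mk, map_sum]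
    simp only [PowerSeries.coeff_mk, MvPowerSeries.coeff_mul, coeff_homogeneousPart]
    rw [Finset.sum_comm]
    have key (p) (hp : p ∈ Finset.HasAntidiagonal.antidiagonal e) :
        ∑ x ∈ Finset.HasAntidiagonal.antidiagonal m,
        (if p.1 i = x.1 then MvPowerSeries.coeff p.1 a else 0) *
        (if p.2 i = x.2 then MvPowerSeries.coeff p.2 b else 0) =
        if e i = m then MvPowerSeries.coeff p.1 a * MvPowerSeries.coeff p.2 b else 0 := by
      have he : p.1 i + p.2 i = e i := by
        rw [← Finset.HasAntidiagonal.mem_antidiagonal.1 hp]; rfl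
      split_ifs with h
      · rw [Finset.sum_eq_single (p.1 i, p.2 i)]
        · simp
        · rintro ⟨x, y⟩ hxy hne
          by_cases hx : p.1 i = x
          · by_cases hy : p.2 i = y
            · exact absurd (by rw [hx, hy]) hne
            · simp [hy]
          · simp [hx]
        · intro h'; simp [he, h] at h'
      · refine Finset.sum_eq_zero fun x hx => ?_
        by_cases hx1 : p.1 i = x.1
        · by_cases hx2 : p.2 i = x.2
          · refine absurd ?_ h
            rw [← he, hx1, hx2]; exact Finset.HasAntidiagonal.mem_antidiagonal.1 hx
          · simp [hx2]
        · simp [hx1]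
    rw [Finset.sum_congr rfl key]
    split_ifs <;> simp

theorem coeff_gradeHom {K : Type*} [Field K] {σ : Type*} (i : σ) (a : MvPowerSeries σ K) (m : ℕ)
    (e : σ →₀ ℕ) : MvPowerSeries.coeff e (PowerSeries.coeff m (gradeHom K i a)) =
      if e i = m then MvPowerSeries.coeff e a else 0 := by
  change MvPowerSeries.coeff e (PowerSeries.coeff m
    (PowerSeries.mk fun m => homogeneousPart i m a)) = _
  rw [PowerSeries.coeff_mk, coeff_homogeneousPart]

/-- Divisibility by a power of `X i` can be tested in `E[[Y]]` after the substitution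
`X i ↦ X i * Y`, as it amounts to divisibility by that power of `Y`. -/
theorem X_pow_dvd_of_gradeHom {K E : Type*} [Field K] [CommRing E] {σ : Type*} (i : σ)
    {ψ : MvPowerSeries σ K →+* E} (hψ : Function.Injective ψ) (m : ℕ) {a b : MvPowerSeries σ K}
    (ha : MvPowerSeries.X i ^ m ∣ a)
    (h : PowerSeries.map ψ (gradeHom K i a) ∣ PowerSeries.map ψ (gradeHom K i b)) :
    MvPowerSeries.X i ^ m ∣ b := by
  have h1 : (PowerSeries.X ^ m : PowerSeries E) ∣ PowerSeries.map ψ (gradeHom K i a) := by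
    rw [PowerSeries.X_pow_dvd_iff]
    intro k hk
    rw [PowerSeries.coeff_map]
    convert map_zero ψ
    ext e
    rw [coeff_gradeHom]
    split_ifs with he
    · exact MvPowerSeries.X_pow_dvd_iff.1 ha e (by omega)
    · simp
  rw [MvPowerSeries.X_pow_dvd_iff]
  intro e he
  have h2 := PowerSeries.X_pow_dvd_iff.1 (h1.trans h) (e i) he
  rw [PowerSeries.coeff_map, map_eq_zero_iff ψ hψ] at h2
  have h3 := congrArg (MvPowerSeries.coeff e) h2
  rwa [coeff_gradeHom, if_pos rfl, map_zero] at h3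

/-- A derivation of `E` acts on `E[[Y]]` coefficientwise. -/
theorem exists_coeffDerivation {E : Type*} [CommRing E] (D : IntDerivation E) :
    ∃ D' : IntDerivation (PowerSeries E), ∀ f m,
      PowerSeries.coeff m (D' f) = D (PowerSeries.coeff m f) := by
  let l : PowerSeries E →+ PowerSeries E :=
    AddMonoidHom.mk' (fun f => PowerSeries.mk fun m => D (PowerSeries.coeff m f))
      fun f g => by ext; simp
  have hl (f : PowerSeries E) (m : ℕ) :
      PowerSeries.coeff m (l f) = D (PowerSeries.coeff m f) :=
    PowerSeries.coeff_mk m fun m => D (PowerSeries.coeff m f)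
  refine ⟨intDerivation l fun f g => ?_, hl⟩
  ext m
  change PowerSeries.coeff m (l (f * g)) = PowerSeries.coeff m (f * l g + g * l f)
  rw [mul_comm g, map_add, hl, PowerSeries.coeff_mul, PowerSeries.coeff_mul, PowerSeries.coeff_mul,
    map_sum, ← Finset.sum_add_distrib]
  refine Finset.sum_congr rfl fun x _ => ?_
  rw [Derivation.leibniz, hl, hl, smul_eq_mul, smul_eq_mul, mul_comm (PowerSeries.coeff x.2 g)]

/-- Along the substitution `X i ↦ X i * Y`, the partial derivatives extend to `E[[Y]]`: those with
respect to the other variables act on the coefficients, and `∂/∂X i` becomes `(X i)⁻¹ * d/dY`. -/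
theorem exists_derivation_powerSeries {K E σ : Type*} [Field K] [Field E] (i : σ)
    {ψ : MvPowerSeries σ K →+* E} (hψ : Function.Injective ψ) (D : σ → IntDerivation E)
    (hD : ∀ k a, D k (ψ a) = ψ (MvPowerSeries.pderiv K k a)) :
    ∃ D' : σ → IntDerivation (PowerSeries E), ∀ k a,
      D' k (PowerSeries.map ψ (gradeHom K i a)) =
        PowerSeries.map ψ (gradeHom K i (MvPowerSeries.pderiv K k a)) := by
  classical
  choose Dc hDc using fun k => exists_coeffDerivation (D k)
  refine ⟨fun k => if k = i then
    intDerivation ((AddMonoidHom.mulLeft (PowerSeries.C (ψ (MvPowerSeries.X i))⁻¹)).comp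
      (PowerSeries.derivative E : PowerSeries E →+ PowerSeries E)) fun f g => by
        change _ * PowerSeries.derivative E (f * g) = f • (_ * PowerSeries.derivative E g) +
          g • (_ * PowerSeries.derivative E f)
        rw [Derivation.leibniz]
        simp only [smul_eq_mul]
        ring
    else Dc k, fun k a => ?_⟩
  ext m
  beta_reduce
  split_ifs with hk
  · subst hk
    have hx : ψ (MvPowerSeries.X k) ≠ 0 := by
      rw [Ne, map_eq_zero_iff ψ hψ]
      intro h
      simpa using congrArg (MvPowerSeries.coeff (Finsupp.single k 1)) h
    change PowerSeries.coeff m (PowerSeries.C (ψ (MvPowerSeries.X k))⁻¹ *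
      PowerSeries.derivative E _) = _
    rw [PowerSeries.coeff_C_mul, PowerSeries.coeff_derivative, inv_mul_eq_iff_eq_mul₀ hx,
      PowerSeries.coeff_map, PowerSeries.coeff_map, ← map_mul]
    have : ((m : E) + 1) = ψ (m + 1) := by simp
    rw [this, ← map_mul]
    congr 1
    ext e
    have h1 : ((m : MvPowerSeries σ K) + 1) = MvPowerSeries.C ((m : K) + 1) := by simp
    rw [h1, MvPowerSeries.coeff_mul_C, coeff_gradeHom]
    by_cases he : e k = 0
    · rw [if_neg (by omega), zero_mul, ← pow_one (MvPowerSeries.X k : MvPowerSeries σ K)]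
      exact (MvPowerSeries.X_pow_dvd_iff.1
        (dvd_mul_right (MvPowerSeries.X k ^ 1 : MvPowerSeries σ K) _) e
        (by omega)).symm
    · obtain ⟨f, rfl⟩ : ∃ f, e = Finsupp.single k 1 + f :=
        ⟨e - Finsupp.single k 1, (add_tsub_cancel_of_le (by
          rw [Finsupp.single_le_iff]; omega)).symm⟩
      rw [MvPowerSeries.X, MvPowerSeries.coeff_add_monomial_mul, one_mul, coeff_gradeHom]
      rw [MvPowerSeries.coeff_pderiv, add_comm f]
      by_cases hf : f k = m
      · simp [hf, add_comm]
      · rw [if_neg hf, if_neg (by simp; omega), zero_mul]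
  · rw [hDc, PowerSeries.coeff_map, PowerSeries.coeff_map, hD]
    congr 1
    ext e
    rw [MvPowerSeries.coeff_pderiv, coeff_gradeHom, coeff_gradeHom, MvPowerSeries.coeff_pderiv]
    have : (e + Finsupp.single k 1 : σ →₀ ℕ) i = e i := by
      simp [Finsupp.single_eq_of_ne (Ne.symm hk)]
    rw [this]
    split_ifs <;> simp

theorem prod_X_pow_dvd {K σ : Type*} [Field K] (s : Finset σ) (γ : σ → ℕ) {a : MvPowerSeries σ K}
    (h : ∀ i ∈ s, MvPowerSeries.X i ^ γ i ∣ a) : ∏ i ∈ s, MvPowerSeries.X i ^ γ i ∣ a := by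
  classical
  induction s using Finset.induction generalizing a with
  | empty => simp
  | insert i s hi ih =>
    obtain ⟨b, rfl⟩ := h i (by simp)
    rw [Finset.prod_insert hi]
    refine mul_dvd_mul_left _ (ih fun j hj => ?_)
    have hij : j ≠ i := fun h => hi (h ▸ hj)
    have h1 := MvPowerSeries.X_pow_dvd_iff.1 (h j (by simp [hj]))
    rw [MvPowerSeries.X_pow_dvd_iff]
    intro e he
    have h2 := h1 (Finsupp.single i (γ i) + e) (by simp [hij, he])
    rwa [MvPowerSeries.X_pow_eq, MvPowerSeries.coeff_add_monomial_mul, one_mul] at h2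

/-! ### Adjoining roots of variables -/

/-- The coefficients of `a(X₁ ^ q, …, X_r ^ q, X_{r+1}, …, Xₙ)`. -/
theorem coeff_toRootSeries (K : Type*) [Field K] (n r : ℕ) {q : ℕ} (hq : q ≠ 0)
    (a : MvPowerSeries (Fin n) K) (e : Fin n →₀ ℕ) :
    MvPowerSeries.coeff e (toRootSeries K n r hq a) =
      if ∀ j : Fin n, (j : ℕ) < r → q ∣ e j then
        MvPowerSeries.coeff (Finsupp.equivFunOnFinite.symm
          fun j : Fin n => if (j : ℕ) < r then e j / q else e j) a
      else 0 := by
  classical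
  have hmon (d : Fin n →₀ ℕ) : (d.prod fun s m => powVar K n r q s ^ m) =
      MvPowerSeries.monomial (Finsupp.equivFunOnFinite.symm
        fun j : Fin n => if (j : ℕ) < r then q * d j else d j) 1 := by
    rw [MvPowerSeries.monomial_one_eq, Finsupp.prod_fintype _ _ (by simp),
      Finsupp.prod_fintype _ _ (by simp)]
    refine Finset.prod_congr rfl fun j _ => ?_
    simp only [powVar, Finsupp.coe_equivFunOnFinite_symm]
    split_ifs
    · rw [pow_mul]
    · rfl
  change MvPowerSeries.coeff e (MvPowerSeries.substAlgHom (hasSubst_powVar K n r hq) a) = _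
  rw [MvPowerSeries.substAlgHom_apply, MvPowerSeries.coeff_subst (hasSubst_powVar K n r hq)]
  simp only [hmon, MvPowerSeries.coeff_monomial]
  split_ifs with h
  · rw [finsum_eq_single _ (Finsupp.equivFunOnFinite.symm
      fun j : Fin n => if (j : ℕ) < r then e j / q else e j)]
    · rw [if_pos, smul_eq_mul, mul_one]
      ext j
      simp only [Finsupp.coe_equivFunOnFinite_symm]
      split_ifs with hj
      · exact (Nat.mul_div_cancel' (h j hj)).symm
      · rfl
    · intro d hd
      rw [if_neg, smul_zero]
      intro he
      refine hd ?_
      ext j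
      have := DFunLike.congr_fun he j
      simp only [Finsupp.coe_equivFunOnFinite_symm] at this ⊢
      split_ifs at this ⊢ with hj
      · rw [this, Nat.mul_div_cancel_left _ (Nat.pos_of_ne_zero hq)]
      · exact this.symm
  · refine finsum_eq_zero_of_forall_eq_zero fun d => ?_
    rw [if_neg, smul_zero]
    intro he
    refine h fun j hj => ?_
    have := DFunLike.congr_fun he j
    simp only [Finsupp.coe_equivFunOnFinite_symm, if_pos hj] at this
    exact ⟨_, this⟩

theorem homogeneousPart_toRootSeries (K : Type*) [Field K] (n r : ℕ) {q : ℕ} (hq : q ≠ 0)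
    (a : MvPowerSeries (Fin n) K) {i : Fin n} (hi : (i : ℕ) < r) (m : ℕ) :
    homogeneousPart i m (toRootSeries K n r hq a) =
      if q ∣ m then toRootSeries K n r hq (homogeneousPart i (m / q) a) else 0 := by
  ext e
  rw [coeff_homogeneousPart, coeff_toRootSeries]
  by_cases h : ∀ j : Fin n, (j : ℕ) < r → q ∣ e j
  · obtain ⟨t, ht⟩ := h i hi
    have hq0 := Nat.pos_of_ne_zero hq
    split_ifs with h1 h2 h2
    · rw [coeff_toRootSeries, if_pos h, coeff_homogeneousPart, if_pos]
      simp [hi, h1]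
    · exact absurd ⟨t, h1 ▸ ht⟩ h2
    · rw [coeff_toRootSeries, if_pos h, coeff_homogeneousPart, if_neg]
      obtain ⟨u, rfl⟩ := h2
      simp only [Finsupp.coe_equivFunOnFinite_symm, if_pos hi, ht, Nat.mul_div_cancel_left _ hq0]
      rintro rfl
      exact h1 ht
    · simp
  · rw [if_neg h, ite_self]
    split_ifs
    · rw [coeff_toRootSeries, if_neg h]
    · simp

/-- After `X i ↦ X i * Y`, the substitution of `q`-th powers is the substitution `Y ↦ Y ^ q` up to a
change of the coefficients. -/
theorem map_gradeHom_toRootSeries (K : Type*) [Field K] {E : Type*} [Field E] (n r : ℕ) {q : ℕ}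
    (hq : q ≠ 0) (ψ : MvPowerSeries (Fin n) K →+* E) {i : Fin n} (hi : (i : ℕ) < r)
    (a : MvPowerSeries (Fin n) K) :
    PowerSeries.map ψ (gradeHom K i (toRootSeries K n r hq a)) =
      expandHom E q hq (PowerSeries.map (ψ.comp (toRootSeries K n r hq)) (gradeHom K i a)) := by
  have hg (b : MvPowerSeries (Fin n) K) (m : ℕ) :
      PowerSeries.coeff m (gradeHom K i b) = homogeneousPart i m b :=
    PowerSeries.coeff_mk m fun m => homogeneousPart i m b
  ext m
  rw [coeff_expandHom, PowerSeries.coeff_map, PowerSeries.coeff_map, hg, hg,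
    homogeneousPart_toRootSeries K n r hq a hi]
  split_ifs <;> simp

/-! ### Integrality of the derivatives of roots -/

theorem prod_X_sub_C_scaleRoots {E ι : Type*} [CommRing E] [IsDomain E] (s : Finset ι) (y : ι → E)
    (c : E) : (∏ j ∈ s, (X - C (y j))).scaleRoots c = ∏ j ∈ s, (X - C (c * y j)) := by
  classical
  induction s using Finset.induction with
  | empty => simp
  | insert i s hi ih =>
    rw [Finset.prod_insert hi, Finset.prod_insert hi, mul_scaleRoots_of_noZeroDivisors, ih,
      X_sub_C_scaleRoots, mul_comm (y i)]

theorem map_coeff_eq_of_map_eq_prod {R E : Type*} [CommRing R] [CommRing E] [IsDomain E]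
    {φ : R →+* E} {χ : R[X]} {d : ℕ} {c : R} {y : Fin d → E}
    (h : χ.map φ = ∏ j, (X - C (φ c * y j))) (k : ℕ) :
    φ (χ.coeff k) = (∏ j, (X - C (y j))).coeff k * φ (c ^ (d - k)) := by
  have hd : (∏ j, (X - C (y j))).natDegree = d := by
    rw [natDegree_prod_of_monic _ _ fun j _ => monic_X_sub_C _]; simp
  rw [← coeff_map, h, ← prod_X_sub_C_scaleRoots, coeff_scaleRoots, hd, map_pow]

/-- If the polynomial with roots `c * y j` lifts to `R` and its coefficients are divisible by the
appropriate powers of `c`, then the polynomial with roots `y j` lifts to `R`. -/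
theorem exists_monic_map_eq_prod {R E : Type*} [CommRing R] [CommRing E] [IsDomain E]
    {φ : R →+* E} {χ : R[X]} {d : ℕ} {c : R} (hc : φ c ≠ 0) {y : Fin d → E}
    (h : χ.map φ = ∏ j, (X - C (φ c * y j))) (hdvd : ∀ k, c ^ (d - k) ∣ χ.coeff k) :
    ∃ p : R[X], p.Monic ∧ p.map φ = ∏ j, (X - C (y j)) := by
  have hlift : (∏ j, (X - C (y j))) ∈ lifts φ := by
    rw [lifts_iff_coeff_lifts]
    intro k
    obtain ⟨b, hb⟩ := hdvd k
    refine ⟨b, ?_⟩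
    have h1 := map_coeff_eq_of_map_eq_prod h k
    rw [hb, map_mul, mul_comm, map_pow] at h1
    exact mul_right_cancel₀ (pow_ne_zero _ hc) h1
  obtain ⟨p, hp, -, hpm⟩ := lifts_and_degree_eq_and_monic hlift
    (monic_prod_of_monic _ _ fun j _ => monic_X_sub_C _)
  exact ⟨p, hpm, hp⟩

theorem exists_eq_prod_of_splits {E : Type*} [CommRing E] [IsDomain E] {Q : E[X]} (hQ : Q.Monic)
    (h : Q.Splits) {d : ℕ} (hd : Q.natDegree = d) : ∃ y : Fin d → E, Q = ∏ j, (X - C (y j)) := by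
  have h1 := h.eq_prod_roots_of_monic hQ
  have h2 := h.natDegree_eq_card_roots
  obtain ⟨l, hl⟩ := Quot.exists_rep Q.roots
  change (l : Multiset E) = _ at hl
  rw [← hl] at h1 h2
  rw [hd, Multiset.coe_card] at h2
  subst h2
  refine ⟨l.get, ?_⟩
  conv_lhs => rw [h1]
  rw [Multiset.map_coe, Multiset.prod_coe, ← List.prod_ofFn]
  congr 1
  conv_lhs => rw [← List.ofFn_get l, List.map_ofFn]
  rfl

theorem eval₂_eq_zero_of_map_eq_prod {R E ι : Type*} [CommRing R] [CommRing E] [Fintype ι]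
    {φ : R →+* E} {Q : R[X]} {y : ι → E} (h : Q.map φ = ∏ j, (X - C (y j))) (j : ι) :
    Q.eval₂ φ (y j) = 0 := by
  rw [← eval_map, h, eval_prod]
  exact Finset.prod_eq_zero (Finset.mem_univ j) (by simp)

/-- Suppose that the discriminant of `Q` is a unit times a monomial in the variables `X i`, `i ∈ s`, and
that `Q` splits in `Ω[[Y]]` after `X i ↦ X i * Y`, for each `i ∈ s`. Then the monic polynomial whose
roots are a fixed iterated derivative of the roots of `Q` has power series as coefficients. -/
theorem exists_monic_map_eq_prod_iterate.{u} {K Ω : Type u} {σ : Type} [Field K] [Field Ω]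
    {ψ : MvPowerSeries σ K →+* Ω} (hψ : Function.Injective ψ) (D : σ → IntDerivation Ω)
    (hD : ∀ k a, D k (ψ a) = ψ (MvPowerSeries.pderiv K k a))
    {Q : (MvPowerSeries σ K)[X]} (hQ : Q.Monic) {s : Finset σ} {γ : σ → ℕ} {U : MvPowerSeries σ K}
    (hU : IsUnit U) (hdisc : Q.discr = (∏ i ∈ s, MvPowerSeries.X i ^ γ i) * U)
    (hs : ∀ i ∈ s, (Q.map ((PowerSeries.map ψ).comp (gradeHom K i))).Splits)
    {θ : Fin Q.natDegree → Ω} (hθ : Q.map ψ = ∏ j, (X - C (θ j))) (w : List σ) :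
    ∃ p : (MvPowerSeries σ K)[X], p.Monic ∧
      p.map ψ = ∏ j, (X - C (w.foldr (fun i x => D i x) (θ j))) := by
  obtain ⟨N, g, hg⟩ := exists_pow_discr_mul_eq_eval₂ hQ
    (pderivInt K) w
  obtain ⟨χ, hχ⟩ := exists_map_eq_prod_X_sub_C_eval₂ (Q := Q) g
  have hX (i : σ) : (MvPowerSeries.X i : MvPowerSeries σ K) ≠ 0 := fun h => by
    classical
    simpa [MvPowerSeries.X] using congrArg (MvPowerSeries.coeff (Finsupp.single i 1)) h
  have hdisc0 : Q.discr ≠ 0 := by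
    rw [hdisc]
    exact mul_ne_zero (Finset.prod_ne_zero_iff.2 fun i _ => pow_ne_zero _ (hX i)) hU.ne_zero
  have hmul {E : Type u} [CommRing E] [IsDomain E] (φ : MvPowerSeries σ K →+* E)
      (D' : σ → IntDerivation E) (hD' : ∀ k a, D' k (φ a) = φ (MvPowerSeries.pderiv K k a))
      (y : Fin Q.natDegree → E) (hy : Q.map φ = ∏ j, (X - C (y j))) :
      χ.map φ = ∏ j, (X - C (φ (Q.discr ^ N) * w.foldr (fun i x => D' i x) (y j))) := by
    rw [hχ E φ y hy]
    refine Finset.prod_congr rfl fun j _ => ?_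
    rw [← hg E φ D' hD' (y j) (eval₂_eq_zero_of_map_eq_prod hy j), map_pow]
  refine exists_monic_map_eq_prod (c := Q.discr ^ N) ?_ (hmul ψ D hD θ hθ) fun k => ?_
  · rw [Ne, map_eq_zero_iff ψ hψ]
    exact pow_ne_zero _ hdisc0
  · have hpow : (Q.discr ^ N) ^ (Q.natDegree - k) =
        (∏ i ∈ s, MvPowerSeries.X i ^ (γ i * (N * (Q.natDegree - k)))) *
          U ^ (N * (Q.natDegree - k)) := by
      rw [← pow_mul, hdisc, mul_pow, ← Finset.prod_pow]
      simp only [pow_mul]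
    rw [hpow, (hU.pow _).mul_right_dvd]
    refine prod_X_pow_dvd s _ fun i hi => X_pow_dvd_of_gradeHom i hψ _
      (a := (Q.discr ^ N) ^ (Q.natDegree - k)) ?_ ?_
    · rw [hpow]
      exact (Finset.dvd_prod_of_mem _ hi).mul_right _
    · obtain ⟨D', hD'⟩ := exists_derivation_powerSeries i hψ D hD
      obtain ⟨η, hη⟩ := exists_eq_prod_of_splits (hQ.map _) (hs i hi) (hQ.natDegree_map _)
      exact Dvd.intro_left _ (map_coeff_eq_of_map_eq_prod
        (hmul ((PowerSeries.map ψ).comp (gradeHom K i)) D' hD' η hη) k).symm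

/-! ### Splitting by Taylor expansion -/

/-- A polynomial over the ring of power series splits if it splits in an extension to which the partial
derivatives extend and in which all iterated derivatives of its roots are integral. -/
theorem exists_eq_prod_of_isIntegral_iterate {K Ω σ ι : Type*} [Field K] [IsAlgClosed K]
    [CharZero K] [CommRing Ω] [Algebra (MvPowerSeries σ K) Ω] [Fintype ι]
    (hinj : Function.Injective (algebraMap (MvPowerSeries σ K) Ω)) (D : σ → IntDerivation Ω)
    (hcomm : ∀ i j x, D i (D j x) = D j (D i x))
    (hD : ∀ k a, D k (algebraMap (MvPowerSeries σ K) Ω a) =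
      algebraMap _ Ω (MvPowerSeries.pderiv K k a))
    {Q : (MvPowerSeries σ K)[X]} {θ : ι → Ω}
    (hθ : Q.map (algebraMap _ Ω) = ∏ j, (X - C (θ j)))
    (hint : ∀ (w : List σ) j, IsIntegral (MvPowerSeries σ K) (w.foldr (fun i x => D i x) (θ j))) :
    ∃ f : ι → MvPowerSeries σ K, Q = ∏ j, (X - C (f j)) := by
  let G : Set Ω := Set.range fun p : List σ × ι => p.1.foldr (fun i x => D i x) (θ p.2)
  let S := Algebra.adjoin (MvPowerSeries σ K) G
  have hSint : Algebra.IsIntegral (MvPowerSeries σ K) S := Algebra.IsIntegral.adjoin (by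
    rintro _ ⟨⟨w, j⟩, rfl⟩; exact hint w j)
  have hstab (i : σ) (x : Ω) (hx : x ∈ S) : D i x ∈ S := by
    induction hx using Algebra.adjoin_induction with
    | mem x hx =>
      obtain ⟨⟨w, j⟩, rfl⟩ := hx
      exact Algebra.subset_adjoin ⟨⟨i :: w, j⟩, rfl⟩
    | algebraMap a => rw [hD]; exact Subalgebra.algebraMap_mem _ _
    | add x y _ _ hx hy => rw [map_add]; exact add_mem hx hy
    | mul x y hx hy hx' hy' =>
      rw [Derivation.leibniz]
      exact add_mem (mul_mem hx hy') (mul_mem hy hx')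
  have hDS (i : σ) : ∃ D' : IntDerivation S, ∀ x : S, (D' x : Ω) = D i x :=
    ⟨intDerivation (AddMonoidHom.mk' (fun x : S => (⟨D i x, hstab i x x.2⟩ : S))
      fun x y => Subtype.ext (map_add (D i) _ _))
      fun x y => Subtype.ext ((D i).leibniz x y), fun _ => rfl⟩
  choose DS hDS using hDS
  have hSinj : Function.Injective (algebraMap (MvPowerSeries σ K) S) := fun a b h =>
    hinj (congrArg Subtype.val h)
  obtain ⟨ε, hε⟩ := exists_hom_of_isIntegral hSinj
    (MvPowerSeries.constantCoeff : MvPowerSeries σ K →+* K)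
    fun a => ⟨MvPowerSeries.C a, MvPowerSeries.constantCoeff_C a⟩
  obtain ⟨T, hT⟩ := exists_taylor_retraction DS
    (fun i j x => Subtype.ext (by rw [hDS, hDS, hDS, hDS, hcomm]))
    (fun i a => Subtype.ext (by rw [hDS]; exact hD i a)) ε hε
  let θS (j : ι) : S := ⟨θ j, Algebra.subset_adjoin ⟨⟨[], j⟩, rfl⟩⟩
  have hQS : Q.map (algebraMap _ S) = ∏ j, (X - C (θS j)) := by
    apply map_injective S.val.toRingHom Subtype.val_injective
    rw [Polynomial.map_map, Polynomial.map_prod]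
    simp only [Polynomial.map_sub, map_X, map_C]
    exact hθ
  refine ⟨fun j => T (θS j), ?_⟩
  have h := congrArg (Polynomial.map T) hQS
  rw [Polynomial.map_map, show T.comp (algebraMap _ S) = RingHom.id _ from RingHom.ext hT,
    Polynomial.map_id, Polynomial.map_prod] at h
  simpa only [Polynomial.map_sub, map_X, map_C] using h

end AbhyankarJung

/-! ### The Abhyankar–Jung theorem -/

open AbhyankarJung

theorem mainTheorem2 {K : Type*} [Field K] [IsAlgClosed K] [CharZero K] {n r : ℕ} (hr : r ≤ n)
    (P : Polynomial (MvPowerSeries (Fin n) K)) (hP : AbhyankarJung.IsWeierstrass P)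
    (α : Fin r → ℕ) (U : MvPowerSeries (Fin n) K) (hU : MvPowerSeries.constantCoeff U ≠ 0)
    (hdisc : P.discr = (∏ i : Fin r, MvPowerSeries.X (Fin.castLE hr i) ^ α i) * U) :
    ∃ (q : ℕ) (hq : q ≠ 0), AbhyankarJung.HasRootsInRootSeries P r hq := by
  have hPm := hP.1
  let R := MvPowerSeries (Fin n) K
  let Ω := AlgebraicClosure (FractionRing R)
  have : CharZero R := charZero_of_injective_algebraMap (algebraMap K R).injective
  have : CharZero (FractionRing R) :=
    charZero_of_injective_algebraMap (IsFractionRing.injective R (FractionRing R))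
  have : CharZero Ω := charZero_of_injective_algebraMap (algebraMap (FractionRing R) Ω).injective
  have : Algebra.FormallyEtale R (FractionRing R) := .of_isLocalization (nonZeroDivisors R)
  have : Algebra.FormallyEtale (FractionRing R) Ω := .of_isSeparable _ _
  have : Algebra.FormallyEtale R Ω := .comp R (FractionRing R) Ω
  have hinj : Function.Injective (algebraMap R Ω) := by
    rw [IsScalarTower.algebraMap_eq R (FractionRing R) Ω]
    exact (algebraMap (FractionRing R) Ω).injective.comp
      (IsFractionRing.injective R (FractionRing R))
  obtain ⟨D, hcomm, hD⟩ := exists_derivations (K := K) (σ := Fin n) (Ω := Ω)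
  obtain ⟨q, hq, hsplit⟩ := exists_splits_map_expand Ω P.natDegree
  refine ⟨q, hq, ?_⟩
  set Q := P.map (toRootSeries K n r hq) with hQdef
  have hQ : Q.Monic := hPm.map _
  have hdeg : Q.natDegree = P.natDegree := hPm.natDegree_map _
  have hX (i : Fin r) : toRootSeries K n r hq (MvPowerSeries.X (Fin.castLE hr i)) =
      MvPowerSeries.X (Fin.castLE hr i) ^ q := by
    change MvPowerSeries.substAlgHom (hasSubst_powVar K n r hq) _ = _
    rw [MvPowerSeries.substAlgHom_X, powVar]
    exact if_pos i.2
  have hUu : IsUnit (toRootSeries K n r hq U) :=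
    (MvPowerSeries.isUnit_iff_constantCoeff.2 (isUnit_iff_ne_zero.2 hU)).map _
  let γ (i : Fin n) : ℕ := if h : (i : ℕ) < r then q * α ⟨i, h⟩ else 0
  have hQdisc : Q.discr = (∏ i ∈ Finset.univ.map (Fin.castLEEmb hr), MvPowerSeries.X i ^ γ i) *
      toRootSeries K n r hq U := by
    rw [hQdef, discr_map_of_monic hPm, hdisc, map_mul, map_prod, Finset.prod_map]
    congr 1
    refine Finset.prod_congr rfl fun i _ => ?_
    rw [map_pow, hX, ← pow_mul]
    simp [γ]
  have hs : ∀ i ∈ Finset.univ.map (Fin.castLEEmb hr),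
      (Q.map ((PowerSeries.map (algebraMap R Ω)).comp (gradeHom K i))).Splits := by
    intro i hi
    obtain ⟨i, -, rfl⟩ := Finset.mem_map.1 hi
    have h := hsplit (P.map ((PowerSeries.map ((algebraMap R Ω).comp (toRootSeries K n r hq))).comp
      (gradeHom K (Fin.castLEEmb hr i)))) (hPm.map _) (hPm.natDegree_map _).le
    rw [Polynomial.map_map] at h
    rw [hQdef, Polynomial.map_map]
    convert h using 2
    ext1 a
    exact map_gradeHom_toRootSeries K n r hq (algebraMap R Ω) i.2 a
  obtain ⟨θ, hθ⟩ := exists_eq_prod_of_splits (hQ.map (algebraMap R Ω))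
    (IsAlgClosed.splits _) (hQ.natDegree_map _)
  obtain ⟨f, hf⟩ := exists_eq_prod_of_isIntegral_iterate hinj D hcomm hD hθ fun w j => by
    obtain ⟨p, hp, hpw⟩ := exists_monic_map_eq_prod_iterate hinj D hD hQ hUu hQdisc hs hθ w
    exact ⟨p, hp, eval₂_eq_zero_of_map_eq_prod hpw j⟩
  refine ⟨fun j => f (Fin.cast hdeg.symm j), ?_⟩
  refine hf.trans ?_
  exact (Fintype.prod_equiv (finCongr hdeg.symm) _ _ fun _ => rfl).symm
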